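/- Call a set $\Gamma\subseteq\mathbb R^n$ a simple rectifiable curve if $\Gamma=f([c,d])$ for some $c<d$ and some continuous one-to-one $f:[c,d]\to\mathbb R^n$ whose length (the supremum of the lengths of the inscribed polygons) is finite. A dissection of $[0,1]$ is a tuple $a=(t_0,\dots,t_m)$ with $0=t_0<t_1<\dots<t_m=1$, and its mesh is $\max_i(t_{i+1}-t_i)$. Let $\mathcal H^1$ denote one-dimensional Hausdorff measure. Let $\Gamma\subseteq\mathbb R^n$ be a simple rectifiable curve and let $\gamma:[0,1]\to\mathbb R^n$ be a continuous function, not necessarily one-to-one, with $\gamma([0,1])=\Gamma$. For a dissection $a=(t_0,\dots,t_m)$ of $[0,1]$ let $S(a)=\{\gamma(t_0),\dots,\gamma(t_m)\}$. Let $(a_k)_{k\in\mathbb N}$ be a sequence of dissections of $[0,1]$ whose meshes tend to $0$. For each $k$ let $L_k$ be a longest path inside a Euclidean minimum spanning tree of $S(a_k)$, i.e. inside a spanning tree of the complete graph on $S(a_k)$ with straight-line edges whose total edge length is minimal; paths are regarded as subsets of $\mathbb R^n$, and the length of a path is its $\mathcal H^1$ measure. Then, for every choice of these trees and longest paths, $$\lim_{k\to\infty}\mathcal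 H^1(L_k)=\mathcal H^1(\Gamma).$$ -/

import Mathlib

open MeasureTheory Filter Topology Set

/-- A dissection `c = t₀ < t₁ < ⋯ < tₘ = d` of the interval `[c, d]`. -/
structure Dissection (c d : ℝ) where
  m : ℕ
  t : Fin (m + 1) → ℝ
  strictMono : StrictMono t
  first : t 0 = c
  last : t (Fin.last m) = d

/-- The mesh of a dissection: the largest gap `tᵢ₊₁ - tᵢ`. -/
noncomputable def Dissection.mesh {c d : ℝ} (a : Dissection c d) : ℝ :=
  ⨆ i : Fin a.m, (a.t i.succ - a.t i.castSucc)

open Classical in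
/-- The set `S(a) = {γ(t₀), …, γ(tₘ)}` of points sampled from `γ` along a dissection. -/
noncomputable def Dissection.samplePoints {c d : ℝ} {E : Type*} (a : Dissection c d)
    (γ : ℝ → E) : Finset E :=
  Finset.univ.image fun i => γ (a.t i)

/-- `Γ` is a simple rectifiable curve: the image of an interval `[c, d]`, `c < d`, under a
continuous one-to-one map of finite length. The length of `f` on `[c, d]` is the supremum of the
lengths of inscribed polygons, i.e. `eVariationOn f (Icc c d)`. -/
def IsSimpleRectifiableCurve {n : ℕ} (Γ : Set (EuclideanSpace ℝ (Fin n))) : Prop :=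
  ∃ (c d : ℝ) (f : ℝ → EuclideanSpace ℝ (Fin n)), c < d ∧ ContinuousOn f (Icc c d) ∧
    InjOn f (Icc c d) ∧ f '' Icc c d = Γ ∧ eVariationOn f (Icc c d) < ⊤

section Trees

variable {n : ℕ} {S : Finset (EuclideanSpace ℝ (Fin n))}

/-- The Euclidean length of the edge between two points of `S`. -/
noncomputable def edgeLength : Sym2 S → ℝ :=
  Sym2.lift ⟨fun x y => dist x y, fun x y => dist_comm x y⟩

open Classical in
/-- The total length of the edges of a graph with vertex set `S`. -/
noncomputable def totalEdgeLength (T : SimpleGraph S) : ℝ :=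
  ∑ e ∈ T.edgeFinset, edgeLength e

/-- `T` is a Euclidean minimum spanning tree of the point set `S`. -/
def IsEuclideanMST (T : SimpleGraph S) : Prop :=
  T.IsTree ∧ ∀ T' : SimpleGraph S, T'.IsTree → totalEdgeLength T ≤ totalEdgeLength T'

/-- The point set traced by a walk: its starting point (which matters only for the walk without
edges) together with the line segments that are its edges. -/
def walkCarrier {T : SimpleGraph S} {u v : S} (p : T.Walk u v) :
    Set (EuclideanSpace ℝ (Fin n)) :=
  {(u : EuclideanSpace ℝ (Fin n))} ∪
    ⋃ e ∈ p.darts, segment ℝ (e.fst : EuclideanSpace ℝ (Fin n)) (e.snd : EuclideanSpace ℝ (Fin n))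

/-- `p` is a longest path of the graph `T`; length is one-dimensional Hausdorff measure. -/
def IsLongestPath (T : SimpleGraph S) {u v : S} (p : T.Walk u v) : Prop :=
  p.IsPath ∧ ∀ (u' v' : S) (q : T.Walk u' v'), q.IsPath →
    Measure.hausdorffMeasure 1 (walkCarrier q) ≤ Measure.hausdorffMeasure 1 (walkCarrier p)

end Trees

/-- `P` is (the point set of) a longest path inside a Euclidean minimum spanning tree of `S`. -/
def IsLMST {n : ℕ} (S : Finset (EuclideanSpace ℝ (Fin n)))
    (P : Set (EuclideanSpace ℝ (Fin n))) : Prop :=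
  ∃ T : SimpleGraph S, IsEuclideanMST T ∧
    ∃ (u v : S) (p : T.Walk u v), IsLongestPath T p ∧ P = walkCarrier p

/-! Let `f` be an injective parametrization of `Γ`, of length `V`; then `V` is also the Hausdorff
measure of `Γ`. Two bounds on a longest path are needed. Upper: joining the sample points in their
order along `f`, rather than along `γ`, which may backtrack, gives a connected graph of length at
most `V`. The minimum spanning tree, and any path in it, is no longer
(`IsEuclideanMST.totalEdgeLength_le_eVariationOn`). Lower: joining the points in the order of `γ`
gives a connected graph with short edges, so by the bottleneck property
(`IsEuclideanMST.dist_le_of_connected`) the tree has short edges too. The tree path between sample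
points near the two ends of `Γ` is then a connected set close to `Γ`, and
`exists_lt_hausdorffMeasure_of_subset_thickening` makes its measure exceed any given `b < V`. A
longest path is at least as long. -/

/-- The one-dimensional Hausdorff measure of the image of an interval is at most the length. -/
lemma hausdorffMeasure_image_le_eVariationOn {E : Type*} [MetricSpace E] [MeasurableSpace E]
    [BorelSpace E] {f : ℝ → E} {c d : ℝ} (hcd : c ≤ d) (hV : eVariationOn f (Icc c d) < ⊤) :
    Measure.hausdorffMeasure 1 (f '' Icc c d) ≤ eVariationOn f (Icc c d) := by
  set s := Icc c d with hs
  have hf : LocallyBoundedVariationOn f s :=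
    BoundedVariationOn.locallyBoundedVariationOn (ne_of_lt hV)
  have hc : c ∈ s := left_mem_Icc.2 hcd
  -- Parametrized by arc length, the curve is a 1-Lipschitz image of a subset of an interval of
  -- length the variation.
  have hu := has_unit_speed_naturalParameterization f hf hc
  set φ := naturalParameterization f s c
  set v := variationOnFromTo f s c
  have himg : f '' s = φ '' (v '' s) := by
    rw [image_image]
    exact image_congr fun x hx =>
      (edist_eq_zero.1 (edist_naturalParameterization_eq_zero hf hc hx)).symm
  have hlip : LipschitzOnWith 1 φ (v '' s) := by
    have key : ∀ x ∈ v '' s, ∀ y ∈ v '' s, x ≤ y → edist (φ x) (φ y) ≤ edist x y := by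
      intro x hx y hy hxy
      have h1 := hu hx hy
      have h2 : edist (φ x) (φ y) ≤ eVariationOn φ (v '' s ∩ Icc x y) :=
        eVariationOn.edist_le φ ⟨hx, left_mem_Icc.2 hxy⟩ ⟨hy, right_mem_Icc.2 hxy⟩
      rw [h1] at h2
      rw [edist_comm x y, edist_dist y x, Real.dist_eq, abs_of_nonneg (sub_nonneg.2 hxy)]
      simpa using h2
    intro x hx y hy
    rw [ENNReal.coe_one, one_mul]
    rcases le_total x y with h | h
    · exact key x hx y hy h
    · rw [edist_comm, edist_comm x]; exact key y hy x hx h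
  have hsub : v '' s ⊆ Icc 0 (eVariationOn f s).toReal := by
    rintro _ ⟨x, hx, rfl⟩
    refine ⟨variationOnFromTo.nonneg_of_le f s hx.1, ?_⟩
    simp only [v]
    rw [variationOnFromTo.eq_of_le f s hx.1]
    exact ENNReal.toReal_mono hV.ne (eVariationOn.mono f inter_subset_left)
  calc Measure.hausdorffMeasure 1 (f '' s)
      ≤ Measure.hausdorffMeasure 1 (v '' s) := by
        rw [himg]; simpa using hlip.hausdorffMeasure_image_le zero_le_one
    _ ≤ Measure.hausdorffMeasure 1 (Icc 0 (eVariationOn f s).toReal) := measure_mono hsub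
    _ = eVariationOn f s := by
        rw [hausdorffMeasure_real, Real.volume_Icc, sub_zero, ENNReal.ofReal_toReal hV.ne]

/-! ### Lower semicontinuity of length near a simple arc -/

/-- A simple arc admits a continuous extension of its inverse to the whole space. -/
lemma exists_continuous_leftInvOn_Icc {E : Type*} [MetricSpace E] {f : ℝ → E} {c d : ℝ}
    (hf : ContinuousOn f (Icc c d)) (hinj : InjOn f (Icc c d)) :
    ∃ Ψ : E → ℝ, Continuous Ψ ∧ ∀ s ∈ Icc c d, Ψ (f s) = s := by
  have he : IsClosedEmbedding ((Icc c d).domRestrict f) :=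
    Continuous.isClosedEmbedding (continuousOn_iff_continuous_domRestrict.1 hf)
      (injOn_iff_injective.1 hinj)
  obtain ⟨g, hg⟩ := ContinuousMap.exists_extension' he ⟨Subtype.val, continuous_subtype_val⟩
  exact ⟨g, g.continuous, fun s hs => congrFun hg ⟨s, hs⟩⟩

/-- A connected set close to a simple arc, and reaching from near one end to near the other,
contributes at least about `dist (f u) (f v)` to its length between the parameters `u` and `v`. -/
lemma exists_edist_le_hausdorffMeasure_inter {E : Type*} [MetricSpace E] [MeasurableSpace E]
    [BorelSpace E] {f : ℝ → E} {c d : ℝ} (hf : ContinuousOn f (Icc c d)) {Ψ : E → ℝ}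
    (hΨ : Continuous Ψ) (hΨf : ∀ s ∈ Icc c d, Ψ (f s) = s) {u v : ℝ} (hu : u ∈ Icc c d)
    (hv : v ∈ Icc c d) (huv : u ≤ v) {τ : ℝ} (hτ : 0 < τ) :
    ∃ ε > 0, ∀ C : Set E, IsPreconnected C → C ⊆ Metric.thickening ε (f '' Icc c d) →
      (∃ x ∈ C, dist x (f c) < ε) → (∃ y ∈ C, dist y (f d) < ε) →
      edist (f u) (f v) ≤
        Measure.hausdorffMeasure 1 (Ψ ⁻¹' Ioo u v ∩ C) + ENNReal.ofReal (2 * τ) := by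
  rcases huv.eq_or_lt with rfl | huv
  · exact ⟨1, one_pos, fun _ _ _ _ _ => by simp⟩
  have hcd : c ≤ d := hu.1.trans hu.2
  -- `Φ` retracts the space onto the arc and moves points near the arc by less than `τ`; there, `Ψ x
  -- = v` forces `x` to be within `τ` of `f v`, and likewise for `u`.
  set Φ : E → E := fun x => f (projIcc c d hcd (Ψ x)) with hΦ
  have hΦc : Continuous Φ :=
    (continuousOn_iff_continuous_domRestrict.1 hf).comp (continuous_projIcc.comp hΨ)
  have hΦf : ∀ x, ∀ s ∈ Icc c d, Ψ x = s → Φ x = f s := by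
    intro x s hs h
    simp only [hΦ, h, projIcc_of_mem hcd hs]
  have hopen : IsOpen {x | dist x (Φ x) < τ} := isOpen_lt (continuous_id.dist hΦc) continuous_const
  obtain ⟨ε₁, hε₁, h₁⟩ := (isCompact_Icc.image_of_continuousOn hf).exists_thickening_subset_open
    hopen (by
      rintro _ ⟨s, hs, rfl⟩
      simpa [hΦf (f s) s hs (hΨf s hs)] using hτ)
  -- The distance alternative is needed when `u = c`, since then `Ψ (f c) < u` fails.
  have hA : IsOpen {x | Ψ x < v ∧ (Ψ x < u ∨ dist x (f u) < τ)} :=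
    (isOpen_lt hΨ continuous_const).inter ((isOpen_lt hΨ continuous_const).union
      (isOpen_lt (continuous_id.dist continuous_const) continuous_const))
  obtain ⟨ε₂, hε₂, h₂⟩ := Metric.isOpen_iff.1 hA (f c) (by
    refine ⟨by rw [hΨf c (left_mem_Icc.2 hcd)]; exact hu.1.trans_lt huv, ?_⟩
    rcases hu.1.eq_or_lt with h | h
    · right; rw [← h, dist_self]; exact hτ
    · left; rwa [hΨf c (left_mem_Icc.2 hcd)])
  have hB : IsOpen {x | u < Ψ x ∧ (v < Ψ x ∨ dist x (f v) < τ)} :=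
    (isOpen_lt continuous_const hΨ).inter ((isOpen_lt continuous_const hΨ).union
      (isOpen_lt (continuous_id.dist continuous_const) continuous_const))
  obtain ⟨ε₃, hε₃, h₃⟩ := Metric.isOpen_iff.1 hB (f d) (by
    refine ⟨by rw [hΨf d (right_mem_Icc.2 hcd)]; exact huv.trans_le hv.2, ?_⟩
    rcases hv.2.eq_or_lt with h | h
    · right; rw [← h, dist_self]; exact hτ
    · left; rwa [hΨf d (right_mem_Icc.2 hcd)])
  refine ⟨min ε₁ (min ε₂ ε₃), by positivity, ?_⟩
  rintro C hC hCΓ ⟨x₀, hx₀, hx₀c⟩ ⟨x₁, hx₁, hx₁d⟩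
  have hclose : ∀ x ∈ C, dist x (Φ x) < τ := fun x hx =>
    h₁ (Metric.thickening_mono (min_le_left _ _) _ (hCΓ hx))
  have hx₀' := h₂ (hx₀c.trans_le ((min_le_right _ _).trans (min_le_left _ _)))
  have hx₁' := h₃ (hx₁d.trans_le ((min_le_right _ _).trans (min_le_right _ _)))
  set D := dist (f u) (f v)
  set g : E → ℝ := fun x => dist x (f u) with hg
  have hgc : Continuous g := continuous_id.dist continuous_const
  have hfar : ∀ x, dist x (f v) < τ → D - τ < g x := by
    intro x hx
    have := dist_triangle_left (f u) (f v) x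
    simp only [hg, D]; linarith
  have hsub : Ioo τ (D - τ) ⊆ g '' (Ψ ⁻¹' Ioo u v ∩ C) := by
    intro l hl
    -- `h` changes sign along `C`. At a zero, `Ψ x = v` would put `x` near `f v`, where `g x > l`,
    -- and `Ψ x = u` would put it near `f u`, where `g x < l`; both are impossible, leaving `g x =
    -- l` with `Ψ x` strictly between `u` and `v`.
    set h : E → ℝ := fun x => max (Ψ x - v) (min (Ψ x - u) (g x - l)) with hh
    have hhc : Continuous h := by fun_prop
    have h0 : h x₀ ≤ 0 := by
      refine max_le (by linarith [hx₀'.1]) ?_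
      rcases hx₀'.2 with h | h
      · exact (min_le_left _ _).trans (by linarith)
      · exact (min_le_right _ _).trans (by have := hl.1; simp only [hg]; linarith)
    have h1 : 0 ≤ h x₁ := by
      rcases hx₁'.2 with h | h
      · exact le_max_of_le_left (by linarith)
      · refine le_max_of_le_right (le_min (by linarith [hx₁'.1]) ?_)
        linarith [hfar _ h, hl.2]
    obtain ⟨x, hxC, hx⟩ := hC.intermediate_value hx₀ hx₁ hhc.continuousOn ⟨h0, h1⟩
    have hq : Ψ x - v ≤ 0 := (le_max_left _ _).trans_eq hx
    have hq' : Ψ x - v < 0 := by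
      refine lt_of_le_of_ne hq fun hq0 => ?_
      have hd := hclose x hxC
      rw [hΦf x v hv (by linarith)] at hd
      have : 0 < h x := lt_max_of_lt_right (lt_min (by linarith) (by linarith [hfar _ hd, hl.2]))
      linarith
    have hm : min (Ψ x - u) (g x - l) = 0 := by
      rcases max_choice (Ψ x - v) (min (Ψ x - u) (g x - l)) with h | h
      · simp only [hh] at hx; linarith
      · simp only [hh] at hx; linarith
    have hp : 0 ≤ Ψ x - u := hm.symm.le.trans (min_le_left _ _)
    have hp' : 0 < Ψ x - u := by
      refine lt_of_le_of_ne hp fun hp0 => ?_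
      have hd := hclose x hxC
      rw [hΦf x u hu (by linarith)] at hd
      have : min (Ψ x - u) (g x - l) < 0 :=
        min_lt_of_right_lt (by have := hl.1; simp only [hg]; linarith)
      linarith
    refine ⟨x, ⟨⟨by linarith, by linarith⟩, hxC⟩, ?_⟩
    rcases min_choice (Ψ x - u) (g x - l) with h | h <;> linarith
  have hgl : LipschitzOnWith 1 g (Ψ ⁻¹' Ioo u v ∩ C) := (LipschitzWith.dist_left _).lipschitzOnWith
  have hvol : ENNReal.ofReal (D - 2 * τ) ≤ Measure.hausdorffMeasure 1 (Ψ ⁻¹' Ioo u v ∩ C) :=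
    calc ENNReal.ofReal (D - 2 * τ) = Measure.hausdorffMeasure 1 (Ioo τ (D - τ)) := by
          rw [hausdorffMeasure_real, Real.volume_Ioo]; congr 1; ring
      _ ≤ _ := measure_mono hsub
      _ ≤ _ := by simpa using hgl.hausdorffMeasure_image_le zero_le_one
  calc edist (f u) (f v) = ENNReal.ofReal ((D - 2 * τ) + 2 * τ) := by rw [edist_dist]; congr 1; ring
    _ ≤ ENNReal.ofReal (D - 2 * τ) + ENNReal.ofReal (2 * τ) := ENNReal.ofReal_add_le
    _ ≤ _ := by gcongr

/-- Lower semicontinuity of length along connected sets converging to a simple arc. -/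
lemma exists_lt_hausdorffMeasure_of_subset_thickening {E : Type*} [MetricSpace E]
    [MeasurableSpace E] [BorelSpace E] {f : ℝ → E} {c d : ℝ} (hf : ContinuousOn f (Icc c d))
    (hinj : InjOn f (Icc c d)) {b : ENNReal} (hb : b < eVariationOn f (Icc c d)) :
    ∃ ε > 0, ∀ C : Set E, IsPreconnected C → C ⊆ Metric.thickening ε (f '' Icc c d) →
      (∃ x ∈ C, dist x (f c) < ε) → (∃ y ∈ C, dist y (f d) < ε) →
      b < Measure.hausdorffMeasure 1 C := by
  obtain ⟨Ψ, hΨ, hΨf⟩ := exists_continuous_leftInvOn_Icc hf hinj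
  obtain ⟨⟨N, u, hum, hus⟩, hsum⟩ := lt_iSup_iff.1 hb
  simp only at hsum
  obtain ⟨r, hr, hbr⟩ := ENNReal.lt_iff_exists_add_pos_lt.1 hsum
  -- The `N` errors `2 * τ` add up to at most the slack `r`.
  set τ : ℝ := r / (2 * (N + 1)) with hτdef
  have hτ : 0 < τ := by positivity
  choose ε hε key using fun i : ℕ => exists_edist_le_hausdorffMeasure_inter hf hΨ hΨf
    (hus i) (hus (i + 1)) (hum i.le_succ) hτ
  obtain ⟨ε₀, hε₀, hle⟩ : ∃ ε₀ > 0, ∀ i ∈ Finset.range N, ε₀ ≤ ε i := by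
    rcases (Finset.range N).eq_empty_or_nonempty with h | h
    · exact ⟨1, one_pos, by simp [h]⟩
    · exact ⟨(Finset.range N).inf' h ε, by simpa [Finset.lt_inf'_iff] using fun i _ => hε i,
        fun i hi => Finset.inf'_le _ hi⟩
  refine ⟨ε₀, hε₀, ?_⟩
  rintro C hC hCΓ ⟨x, hx, hxc⟩ ⟨y, hy, hyd⟩
  have hU : ∀ i, MeasurableSet (Ψ ⁻¹' Ioo (u i) (u (i + 1))) := fun i =>
    (isOpen_Ioo.preimage hΨ).measurableSet
  have hdisj : Pairwise (Function.onFun Disjoint fun i => Ψ ⁻¹' Ioo (u i) (u (i + 1))) :=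
    fun i j hij => (hum.pairwise_disjoint_on_Ioo_succ hij).preimage Ψ
  have h1 : ∑ i ∈ Finset.range N, Measure.hausdorffMeasure 1 (Ψ ⁻¹' Ioo (u i) (u (i + 1)) ∩ C)
      ≤ Measure.hausdorffMeasure 1 C := by
    simp_rw [← Measure.restrict_apply (hU _)]
    rw [← measure_biUnion_finset (fun i _ j _ hij => hdisj hij) fun i _ => hU i]
    exact (measure_mono (subset_univ _)).trans_eq (Measure.restrict_apply_univ _)
  have h2 : ∑ i ∈ Finset.range N, edist (f (u (i + 1))) (f (u i)) ≤
      Measure.hausdorffMeasure 1 C + r := by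
    calc _ ≤ ∑ i ∈ Finset.range N,
          (Measure.hausdorffMeasure 1 (Ψ ⁻¹' Ioo (u i) (u (i + 1)) ∩ C)
            + ENNReal.ofReal (2 * τ)) := Finset.sum_le_sum fun i hi => by
          rw [edist_comm]
          exact key i C hC (hCΓ.trans (Metric.thickening_mono (hle i hi) _))
            ⟨x, hx, hxc.trans_le (hle i hi)⟩ ⟨y, hy, hyd.trans_le (hle i hi)⟩
      _ ≤ _ := by
          rw [Finset.sum_add_distrib, Finset.sum_const, Finset.card_range, nsmul_eq_mul]
          refine add_le_add h1 ?_
          rw [← ENNReal.ofReal_natCast, ← ENNReal.ofReal_mul (by positivity),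
            ← ENNReal.ofReal_coe_nnreal]
          refine ENNReal.ofReal_le_ofReal ?_
          rw [hτdef]
          have : (0 : ℝ) ≤ r := r.2
          field_simp
          nlinarith
  exact (ENNReal.add_lt_add_iff_right ENNReal.coe_ne_top).1 (hbr.trans_le h2)

/-- The one-dimensional Hausdorff measure of a simple rectifiable curve is its length. -/
lemma hausdorffMeasure_image_eq_eVariationOn {E : Type*} [MetricSpace E] [MeasurableSpace E]
    [BorelSpace E] {f : ℝ → E} {c d : ℝ} (hcd : c ≤ d) (hf : ContinuousOn f (Icc c d))
    (hinj : InjOn f (Icc c d)) (hV : eVariationOn f (Icc c d) < ⊤) :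
    Measure.hausdorffMeasure 1 (f '' Icc c d) = eVariationOn f (Icc c d) := by
  refine (hausdorffMeasure_image_le_eVariationOn hcd hV).antisymm (le_of_forall_lt fun b hb => ?_)
  -- The arc itself serves as the nearby connected set.
  obtain ⟨ε, hε, h⟩ := exists_lt_hausdorffMeasure_of_subset_thickening hf hinj hb
  exact h _ (isPreconnected_Icc.image _ hf) (Metric.self_subset_thickening hε _)
    ⟨f c, mem_image_of_mem f (left_mem_Icc.2 hcd), by simpa⟩
    ⟨f d, mem_image_of_mem f (right_mem_Icc.2 hcd), by simpa⟩

/-! ### Minimum spanning trees: total length and longest edge -/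

section MinimumSpanningTrees

variable {n : ℕ} {S : Finset (EuclideanSpace ℝ (Fin n))}

lemma edgeLength_mk (x y : S) : edgeLength s(x, y) = dist x y := rfl

lemma edgeLength_nonneg (e : Sym2 S) : 0 ≤ edgeLength e := by
  induction e with | h x y => exact dist_nonneg (x := x) (y := y)

lemma totalEdgeLength_mono {T G : SimpleGraph S} (h : T ≤ G) :
    totalEdgeLength T ≤ totalEdgeLength G := by
  classical
  exact Finset.sum_le_sum_of_subset_of_nonneg (SimpleGraph.edgeFinset_mono h)
    fun e _ _ => edgeLength_nonneg e

/-- A minimum spanning tree is no longer than any connected graph on the same points. -/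
lemma IsEuclideanMST.totalEdgeLength_le {T G : SimpleGraph S} (hT : IsEuclideanMST T)
    (hG : G.Connected) : totalEdgeLength T ≤ totalEdgeLength G := by
  obtain ⟨T', hle, hT'⟩ := hG.exists_isTree_le
  exact (hT.2 T' hT').trans (totalEdgeLength_mono hle)

/-- The graph joining consecutive entries of a finite sequence. -/
def chainGraph {V : Type*} {N : ℕ} (g : Fin (N + 1) → V) : SimpleGraph V :=
  SimpleGraph.fromEdgeSet (range fun i : Fin N => s(g i.castSucc, g i.succ))

lemma chainGraph_connected {V : Type*} {N : ℕ} {g : Fin (N + 1) → V}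
    (hg : Function.Surjective g) : (chainGraph g).Connected := by
  have h0 : ∀ i, (chainGraph g).Reachable (g 0) (g i) := by
    intro i
    induction i using Fin.induction with
    | zero => exact .rfl
    | succ i ih =>
      refine ih.trans ?_
      by_cases h : g i.castSucc = g i.succ
      · rw [h]
      · exact SimpleGraph.Adj.reachable ((SimpleGraph.fromEdgeSet_adj _).2 ⟨⟨i, rfl⟩, h⟩)
  rw [SimpleGraph.connected_iff_exists_forall_reachable]
  exact ⟨g 0, fun w => by obtain ⟨i, rfl⟩ := hg w; exact h0 i⟩

lemma totalEdgeLength_chainGraph_le {N : ℕ} (g : Fin (N + 1) → S) :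
    totalEdgeLength (chainGraph g) ≤ ∑ i : Fin N, dist (g i.castSucc) (g i.succ) := by
  classical
  have hsub : (chainGraph g).edgeFinset ⊆
      Finset.univ.image fun i : Fin N => s(g i.castSucc, g i.succ) := by
    intro e he
    rw [SimpleGraph.mem_edgeFinset, chainGraph, SimpleGraph.edgeSet_fromEdgeSet] at he
    simpa using he.1
  rcases isEmpty_or_nonempty (Fin N) with hN | hN
  · have h0 : (chainGraph g).edgeFinset = ∅ := by
      rw [← Finset.subset_empty]; simpa using hsub
    have : totalEdgeLength (chainGraph g) = ∑ e ∈ (chainGraph g).edgeFinset, edgeLength e := by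
      unfold totalEdgeLength; exact Finset.sum_congr (by ext; simp) fun _ _ => rfl
    rw [this, h0]; simp
  -- `g` may traverse an edge repeatedly, so one index is selected per edge.
  choose! j hj using fun e (he : e ∈ (chainGraph g).edgeFinset) => Finset.mem_image.1 (hsub he)
  have hinj : InjOn j (chainGraph g).edgeFinset := fun e he e' he' h => by
    rw [← (hj e he).2, ← (hj e' he').2, h]
  calc totalEdgeLength (chainGraph g)
      = ∑ e ∈ (chainGraph g).edgeFinset, dist (g (j e).castSucc) (g (j e).succ) := by
        unfold totalEdgeLength
        refine Finset.sum_congr (by ext; simp) fun e he => ?_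
        conv_lhs => rw [← (hj e (by simpa using he)).2]
        rfl
    _ = ∑ i ∈ (chainGraph g).edgeFinset.image j, dist (g i.castSucc) (g i.succ) :=
        (Finset.sum_image (f := fun i : Fin N => dist (g i.castSucc) (g i.succ)) hinj).symm
    _ ≤ _ := Finset.sum_le_sum_of_subset_of_nonneg (Finset.subset_univ _)
        fun _ _ _ => dist_nonneg

/-- Bottleneck property: an edge of a minimum spanning tree is no longer than the longest edge of
any connected graph on the same points. -/
lemma IsEuclideanMST.dist_le_of_connected {T G : SimpleGraph S} (hT : IsEuclideanMST T)
    (hG : G.Connected) {ε : ℝ} (hε : ∀ a b, G.Adj a b → dist a b ≤ ε) {x y : S}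
    (hxy : T.Adj x y) : dist x y ≤ ε := by
  classical
  by_contra! hlt
  set T₀ := T.deleteEdges {s(x, y)} with hT₀
  have hbridge : ¬ T₀.Reachable x y :=
    SimpleGraph.isBridge_iff.1 (SimpleGraph.isAcyclic_iff_forall_adj_isBridge.1 hT.1.2 hxy)
  -- Removing `xy` leaves only the components of `x` and `y`.
  have hreach : ∀ w, T₀.Reachable x w ∨ T₀.Reachable y w := by
    intro w
    obtain ⟨p⟩ := hT.1.1.preconnected x w
    by_contra! hw
    obtain ⟨d, -, hd1, hd2⟩ := p.exists_boundary_dart {z | T₀.Reachable x z ∨ T₀.Reachable y z}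
      (Or.inl .rfl) (by rintro (h | h); exacts [hw.1 h, hw.2 h])
    by_cases hd : s(d.fst, d.snd) = s(x, y)
    · refine hd2 ?_
      rcases Sym2.eq_iff.1 hd with ⟨-, h⟩ | ⟨-, h⟩ <;> rw [h]
      exacts [Or.inr .rfl, Or.inl .rfl]
    · have hadj : T₀.Adj d.fst d.snd := by
        rw [hT₀, SimpleGraph.deleteEdges_adj]; exact ⟨d.adj, hd⟩
      exact hd2 (hd1.imp (fun h => h.trans hadj.reachable) fun h => h.trans hadj.reachable)
  obtain ⟨q⟩ := hG.preconnected x y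
  -- Exchange argument: `G` has an edge `d` crossing between the components, and putting it in place
  -- of the longer `xy` gives a shorter connected graph.
  obtain ⟨d, -, hd1, hd2⟩ := q.exists_boundary_dart {z | T₀.Reachable x z} .rfl hbridge
  set T₁ := T₀ ⊔ SimpleGraph.edge d.fst d.snd with hT₁
  have hle : T₀ ≤ T₁ := le_sup_left
  have hde : T₁.Adj d.fst d.snd :=
    Or.inr ((SimpleGraph.edge_adj ..).2 ⟨Or.inl ⟨rfl, rfl⟩, d.adj.ne⟩)
  have hxy₁ : T₁.Reachable x y :=
    (SimpleGraph.Reachable.mono hle hd1).trans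
      (hde.reachable.trans (((hreach d.snd).resolve_left hd2).mono hle).symm)
  have hconn : T₁.Connected := by
    rw [SimpleGraph.connected_iff_exists_forall_reachable]
    exact ⟨x, fun w => (hreach w).elim (fun h => h.mono hle) fun h => hxy₁.trans (h.mono hle)⟩
  have hT₁le : totalEdgeLength T₁ ≤ totalEdgeLength T₀ + dist d.fst d.snd := by
    have hsub : T₁.edgeFinset ⊆ insert s(d.fst, d.snd) T₀.edgeFinset := by
      intro e he
      rw [SimpleGraph.mem_edgeFinset] at he
      rw [Finset.mem_insert, SimpleGraph.mem_edgeFinset]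
      induction e with
      | h a b =>
        rcases he with h | h
        · exact Or.inr h
        · rw [SimpleGraph.edge_adj] at h
          exact Or.inl (Sym2.eq_iff.2 h.1)
    calc totalEdgeLength T₁ = ∑ e ∈ T₁.edgeFinset, edgeLength e := by
          unfold totalEdgeLength; exact Finset.sum_congr (by ext; simp) fun _ _ => rfl
      _ ≤ ∑ e ∈ insert s(d.fst, d.snd) T₀.edgeFinset, edgeLength e :=
          Finset.sum_le_sum_of_subset_of_nonneg hsub fun e _ _ => edgeLength_nonneg e
      _ ≤ edgeLength s(d.fst, d.snd) + ∑ e ∈ T₀.edgeFinset, edgeLength e := by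
          by_cases h : s(d.fst, d.snd) ∈ T₀.edgeFinset
          · rw [Finset.insert_eq_of_mem h]; linarith [edgeLength_nonneg s(d.fst, d.snd)]
          · rw [Finset.sum_insert h]
      _ = totalEdgeLength T₀ + dist d.fst d.snd := by
          rw [add_comm, edgeLength_mk]; unfold totalEdgeLength
          congr 1; exact Finset.sum_congr (by ext; simp) fun _ _ => rfl
  have hTeq : totalEdgeLength T₀ + dist x y ≤ totalEdgeLength T := by
    have hnot : s(x, y) ∉ T₀.edgeFinset := by simp [hT₀]
    have hsub : insert s(x, y) T₀.edgeFinset ⊆ T.edgeFinset :=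
      Finset.insert_subset (by simpa using hxy)
        (SimpleGraph.edgeFinset_mono (SimpleGraph.deleteEdges_le _))
    calc totalEdgeLength T₀ + dist x y
        = ∑ e ∈ insert s(x, y) T₀.edgeFinset, edgeLength e := by
          rw [Finset.sum_insert hnot, add_comm, edgeLength_mk]; unfold totalEdgeLength
          congr 1; exact Finset.sum_congr (by ext; simp) fun _ _ => rfl
      _ ≤ ∑ e ∈ T.edgeFinset, edgeLength e :=
          Finset.sum_le_sum_of_subset_of_nonneg hsub fun e _ _ => edgeLength_nonneg e
      _ = totalEdgeLength T := by
          unfold totalEdgeLength; exact Finset.sum_congr (by ext; simp) fun _ _ => rfl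
  have h1 := hT.totalEdgeLength_le hconn
  have h2 := hε _ _ d.adj
  linarith

/-- A minimum spanning tree of finitely many points of a curve is no longer than the curve. -/
lemma IsEuclideanMST.totalEdgeLength_le_eVariationOn {T : SimpleGraph S} (hT : IsEuclideanMST T)
    {f : ℝ → EuclideanSpace ℝ (Fin n)} {s : Set ℝ} (hS : (S : Set _) ⊆ f '' s) :
    ENNReal.ofReal (totalEdgeLength T) ≤ eVariationOn f s := by
  choose σ hσs hσf using fun x : S => hS x.2
  have hσ : Function.Injective σ := fun x y h => by
    ext1; rw [← hσf x, ← hσf y, h]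
  have : Nonempty S := hT.1.1.nonempty
  obtain ⟨N, hN⟩ := Nat.exists_eq_succ_of_ne_zero (Fintype.card_ne_zero (α := S))
  let : LinearOrder S := LinearOrder.lift' σ hσ
  let g : Fin (N + 1) ≃o S := monoEquivOfFin S hN
  have hmono : Monotone fun i => σ (g i) := fun i j hij => g.monotone hij
  -- Variation is tested on monotone sequences indexed by `ℕ`, so the list of parameters is
  -- continued as a constant.
  let u : ℕ → ℝ := fun i => σ (g ⟨min i N, by omega⟩)
  have hu : Monotone u := fun i j hij => hmono (by
    rw [Fin.mk_le_mk]; exact min_le_min_right _ hij)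
  have hlen := (hT.totalEdgeLength_le (chainGraph_connected g.surjective)).trans
    (totalEdgeLength_chainGraph_le g)
  calc ENNReal.ofReal (totalEdgeLength T)
      ≤ ENNReal.ofReal (∑ i : Fin N, dist (g i.castSucc) (g i.succ)) :=
        ENNReal.ofReal_le_ofReal hlen
    _ = ∑ i : Fin N, edist (f (u (i + 1))) (f (u i)) := by
        rw [ENNReal.ofReal_sum_of_nonneg fun _ _ => dist_nonneg]
        refine Finset.sum_congr rfl fun i _ => ?_
        rw [edist_comm, ← edist_dist]
        have h1 : (⟨min (i : ℕ) N, by omega⟩ : Fin (N + 1)) = i.castSucc := by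
          ext; simp [i.2.le]
        have h2 : (⟨min ((i : ℕ) + 1) N, by omega⟩ : Fin (N + 1)) = i.succ := by
          ext; simp
        simp only [u, h1, h2, hσf]
        rfl
    _ = ∑ i ∈ Finset.range N, edist (f (u (i + 1))) (f (u i)) :=
        Fin.sum_univ_eq_sum_range (fun i => edist (f (u (i + 1))) (f (u i))) N
    _ ≤ eVariationOn f s := eVariationOn.sum_le hu fun i => hσs _

/-! ### Point sets traced by walks -/

lemma walkCarrier_cons {T : SimpleGraph S} {u v w : S} (h : T.Adj u v) (p : T.Walk v w) :
    walkCarrier (SimpleGraph.Walk.cons h p) =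
      segment ℝ (u : EuclideanSpace ℝ (Fin n)) v ∪ walkCarrier p := by
  have hu : (u : EuclideanSpace ℝ (Fin n)) ∈ segment ℝ (u : EuclideanSpace ℝ (Fin n)) v :=
    left_mem_segment ..
  have hv : (v : EuclideanSpace ℝ (Fin n)) ∈ segment ℝ (u : EuclideanSpace ℝ (Fin n)) v :=
    right_mem_segment ..
  ext z
  simp only [walkCarrier, SimpleGraph.Walk.darts_cons, List.mem_cons, iUnion_iUnion_eq_or_left,
    mem_union, mem_singleton_iff]
  constructor
  · rintro (rfl | h | h)
    exacts [Or.inl hu, Or.inl h, Or.inr (Or.inr h)]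
  · rintro (h | rfl | h)
    exacts [Or.inr (Or.inl h), Or.inr (Or.inl hv), Or.inr (Or.inr h)]

lemma start_mem_walkCarrier {T : SimpleGraph S} {u v : S} (p : T.Walk u v) :
    (u : EuclideanSpace ℝ (Fin n)) ∈ walkCarrier p := Or.inl rfl

lemma end_mem_walkCarrier {T : SimpleGraph S} {u v : S} (p : T.Walk u v) :
    (v : EuclideanSpace ℝ (Fin n)) ∈ walkCarrier p := by
  induction p with
  | nil => exact start_mem_walkCarrier _
  | cons h p ih => rw [walkCarrier_cons]; exact Or.inr ih

lemma isPreconnected_walkCarrier {T : SimpleGraph S} {u v : S} (p : T.Walk u v) :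
    IsPreconnected (walkCarrier p) := by
  induction p with
  | nil => simpa [walkCarrier] using isPreconnected_singleton
  | cons h p ih =>
    rw [walkCarrier_cons]
    exact (convex_segment _ _).isPreconnected.union _ (right_mem_segment ..)
      (start_mem_walkCarrier p) ih

lemma walkCarrier_subset_thickening {T : SimpleGraph S} {ε : ℝ} (hε : 0 < ε)
    (hT : ∀ x y : S, T.Adj x y → dist x y < ε) {u v : S} (p : T.Walk u v) :
    walkCarrier p ⊆ Metric.thickening ε (S : Set (EuclideanSpace ℝ (Fin n))) := by
  induction p with
  | nil => simpa [walkCarrier] using Metric.self_subset_thickening hε _ (Subtype.mem _)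
  | @cons u v _ h p ih =>
    rw [walkCarrier_cons]
    refine union_subset (fun z hz => ?_) ih
    refine Metric.mem_thickening_iff.2 ⟨u, u.2, ?_⟩
    exact ((convex_ball (u : EuclideanSpace ℝ (Fin n)) ε).segment_subset
      (Metric.mem_ball_self hε) (by rw [Metric.mem_ball']; exact hT _ _ h)) hz

lemma hausdorffMeasure_walkCarrier_le {T : SimpleGraph S} {u v : S} (p : T.Walk u v) :
    Measure.hausdorffMeasure 1 (walkCarrier p) ≤
      (p.edges.map fun e => ENNReal.ofReal (edgeLength e)).sum := by
  induction p with
  | nil =>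
    have := Measure.nullSingletonClass_hausdorff (EuclideanSpace ℝ (Fin n)) one_pos
    simp [walkCarrier]
  | cons h p ih =>
    rw [walkCarrier_cons, SimpleGraph.Walk.edges_cons, List.map_cons, List.sum_cons]
    refine (measure_union_le _ _).trans (add_le_add ?_ ih)
    rw [hausdorffMeasure_segment, edist_dist]
    rfl

/-- A path repeats no edge, so each edge of the tree is counted at most once. -/
lemma hausdorffMeasure_walkCarrier_le_totalEdgeLength {T : SimpleGraph S} {u v : S}
    {p : T.Walk u v} (hp : p.IsPath) :
    Measure.hausdorffMeasure 1 (walkCarrier p) ≤ ENNReal.ofReal (totalEdgeLength T) := by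
  classical
  refine (hausdorffMeasure_walkCarrier_le p).trans ?_
  rw [← List.sum_toFinset _ hp.isTrail.edges_nodup, totalEdgeLength,
    ENNReal.ofReal_sum_of_nonneg fun e _ => edgeLength_nonneg e]
  refine Finset.sum_le_sum_of_subset fun e he => ?_
  rw [SimpleGraph.mem_edgeFinset]
  exact p.edges_subset_edgeSet (List.mem_toFinset.1 he)

end MinimumSpanningTrees

/-! ### Dissections and their sample points -/

namespace Dissection

variable {c d : ℝ} (a : Dissection c d)

lemma mem_Icc (j : Fin (a.m + 1)) : a.t j ∈ Icc c d :=
  ⟨a.first.symm.trans_le (a.strictMono.monotone (Fin.zero_le j)),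
    (a.strictMono.monotone (Fin.le_last j)).trans_eq a.last⟩

lemma sub_le_mesh (i : Fin a.m) : a.t i.succ - a.t i.castSucc ≤ a.mesh :=
  le_ciSup (f := fun i : Fin a.m => a.t i.succ - a.t i.castSucc) (finite_range _).bddAbove i

lemma mesh_nonneg : 0 ≤ a.mesh :=
  Real.iSup_nonneg fun i => sub_nonneg.2 (a.strictMono.monotone i.castSucc_lt_succ.le)

lemma exists_abs_sub_le_mesh {t : ℝ} (ht : t ∈ Icc c d) : ∃ j, |t - a.t j| ≤ a.mesh := by
  by_cases h : ∃ i : Fin a.m, a.t i.castSucc ≤ t ∧ t < a.t i.succ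
  · obtain ⟨i, h1, h2⟩ := h
    refine ⟨i.castSucc, ?_⟩
    rw [abs_of_nonneg (sub_nonneg.2 h1)]
    linarith [a.sub_le_mesh i]
  -- Only `t = d` escapes the half-open cells.
  · push Not at h
    have hall : ∀ j, a.t j ≤ t := by
      intro j
      induction j using Fin.induction with
      | zero => exact a.first.trans_le ht.1
      | succ i ih => exact h i ih
    have : t = a.t (Fin.last a.m) := le_antisymm (ht.2.trans_eq a.last.symm) (hall _)
    exact ⟨Fin.last a.m, by rw [this, sub_self, abs_zero]; exact a.mesh_nonneg⟩

lemma mem_samplePoints {E : Type*} {γ : ℝ → E} {z : E} :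
    z ∈ a.samplePoints γ ↔ ∃ i, γ (a.t i) = z := by
  simp [samplePoints]

end Dissection

/-- Adjacent vertices of a minimum spanning tree of sample points of `γ` are close together when
consecutive sample points are. -/
lemma IsEuclideanMST.dist_le_of_samplePoints {n : ℕ} {c d : ℝ} {a : Dissection c d}
    {γ : ℝ → EuclideanSpace ℝ (Fin n)} {T : SimpleGraph (a.samplePoints γ)}
    (hT : IsEuclideanMST T) {ε : ℝ}
    (hε : ∀ i : Fin a.m, dist (γ (a.t i.castSucc)) (γ (a.t i.succ)) ≤ ε)
    {x y : a.samplePoints γ} (hxy : T.Adj x y) : dist x y ≤ ε := by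
  let g : Fin (a.m + 1) → a.samplePoints γ := fun i =>
    ⟨γ (a.t i), a.mem_samplePoints.2 ⟨i, rfl⟩⟩
  have hg : Function.Surjective g := by
    rintro ⟨z, hz⟩
    obtain ⟨i, rfl⟩ := a.mem_samplePoints.1 hz
    exact ⟨i, rfl⟩
  refine hT.dist_le_of_connected (chainGraph_connected hg) (fun p q hpq => ?_) hxy
  obtain ⟨⟨i, hi⟩, -⟩ := (SimpleGraph.fromEdgeSet_adj _).1 hpq
  rcases Sym2.eq_iff.1 hi with ⟨rfl, rfl⟩ | ⟨rfl, rfl⟩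
  · exact hε i
  · rw [dist_comm]; exact hε i

theorem theorem4 {n : ℕ} (Γ : Set (EuclideanSpace ℝ (Fin n)))
    (hΓ : IsSimpleRectifiableCurve Γ)
    (γ : ℝ → EuclideanSpace ℝ (Fin n)) (hγ : ContinuousOn γ (Icc 0 1))
    (hγΓ : γ '' Icc 0 1 = Γ)
    (a : ℕ → Dissection 0 1)
    (ha : Tendsto (fun k => (a k).mesh) atTop (𝓝 0))
    (L : ℕ → Set (EuclideanSpace ℝ (Fin n)))
    (hL : ∀ k, IsLMST ((a k).samplePoints γ) (L k)) :
    Tendsto (fun k => Measure.hausdorffMeasure 1 (L k)) atTop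
      (𝓝 (Measure.hausdorffMeasure 1 Γ)) := by
  obtain ⟨c, d, f, hcd, hf, hinj, rfl, hV⟩ := hΓ
  rw [hausdorffMeasure_image_eq_eVariationOn hcd.le hf hinj hV]
  have hS : ∀ k, ((a k).samplePoints γ : Set (EuclideanSpace ℝ (Fin n))) ⊆ f '' Icc c d := by
    intro k z hz
    obtain ⟨i, rfl⟩ := (a k).mem_samplePoints.1 hz
    rw [← hγΓ]
    exact mem_image_of_mem γ ((a k).mem_Icc i)
  refine tendsto_order.2 ⟨fun b hb => ?_, fun b hb => Eventually.of_forall fun k => ?_⟩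
  · obtain ⟨ε, hε, hlow⟩ := exists_lt_hausdorffMeasure_of_subset_thickening hf hinj hb
    obtain ⟨δ, hδ, huc⟩ := Metric.uniformContinuousOn_iff.1
      (isCompact_Icc.uniformContinuousOn_of_continuous hγ) (ε / 2) (half_pos hε)
    filter_upwards [ha.eventually_lt_const hδ] with k hk
    obtain ⟨T, hT, u, v, p, hp, hLp⟩ := hL k
    have hedge : ∀ x y, T.Adj x y → dist x y < ε := by
      intro x y hxy
      refine (hT.dist_le_of_samplePoints (fun i => ?_) hxy).trans_lt (half_lt_self hε)
      refine (huc _ ((a k).mem_Icc _) _ ((a k).mem_Icc _) ?_).le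
      rw [dist_comm, Real.dist_eq, abs_of_nonneg
        (sub_nonneg.2 ((a k).strictMono.monotone i.castSucc_lt_succ.le))]
      exact ((a k).sub_le_mesh i).trans_lt hk
    have hnear : ∀ z ∈ f '' Icc c d, ∃ x : (a k).samplePoints γ,
        dist (x : EuclideanSpace ℝ (Fin n)) z < ε := by
      intro z hz
      rw [← hγΓ] at hz
      obtain ⟨t, ht, rfl⟩ := hz
      obtain ⟨j, hj⟩ := (a k).exists_abs_sub_le_mesh ht
      refine ⟨⟨γ ((a k).t j), (a k).mem_samplePoints.2 ⟨j, rfl⟩⟩, ?_⟩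
      refine (huc _ ((a k).mem_Icc j) t ht ?_).trans (half_lt_self hε)
      rw [dist_comm, Real.dist_eq]
      exact hj.trans_lt hk
    obtain ⟨x, hx⟩ := hnear _ (mem_image_of_mem f (left_mem_Icc.2 hcd.le))
    obtain ⟨y, hy⟩ := hnear _ (mem_image_of_mem f (right_mem_Icc.2 hcd.le))
    -- The longest path need not itself reach both ends of the arc; it is compared with `q`, which
    -- does so up to `ε`.
    obtain ⟨q, hq⟩ := (hT.1.1.preconnected x y).exists_isPath
    rw [hLp]
    refine (hlow (walkCarrier q) (isPreconnected_walkCarrier q) ?_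
      ⟨x, start_mem_walkCarrier q, hx⟩ ⟨y, end_mem_walkCarrier q, hy⟩).trans_le (hp.2 x y q hq)
    exact (walkCarrier_subset_thickening hε hedge q).trans
      (Metric.thickening_subset_of_subset ε (hS k))
  -- The upper bound holds for every `k`, whatever the mesh.
  · obtain ⟨T, hT, u, v, p, hp, hLp⟩ := hL k
    rw [hLp]
    exact ((hausdorffMeasure_walkCarrier_le_totalEdgeLength hp.1).trans
      (hT.totalEdgeLength_le_eVariationOn (hS k))).trans_lt hb
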